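/- For a positive integer $N$ and $\alpha\in[1/2,2]$ let $S_{N,\alpha}$ be the set of rational numbers in $\left[\frac{N^{\alpha-1}}{3},\frac{2N^{\alpha-1}}{3}\right]$ whose denominator in lowest terms is at most $N^{(2-\alpha)/3}$, and let $r_0<r_1<\dots<r_{n-1}$ be its elements in increasing order. A real sequence $a_1,\dots,a_N$ is called uniformly convex if all its first differences lie in $[\frac1{4N},\frac4N]$ and all its second differences lie in $[\frac1{4N^2},\frac4{N^2}]$. Theorem. There is an absolute constant $C>0$ such that for all $\alpha\in[1/2,2]$ and all integers $N\ge 1$ the following hold. 1. $S_{N,\alpha}$ is finite with $|S_{N,\alpha}|\le C N^{(\alpha+1)/3}$, and, if $N^{(2\alpha-1)/3}\ge 300$ (so, for each fixed $\alpha>1/2$, for all sufficiently large $N$), also $|S_{N,\alpha}|\ge C^{-1}N^{(\alpha+1)/3}$. 2. $r_{i+1}-r_i\ge C^{-1}N^{-(4-2\alpha)/3}$ for $0\le i<n-1$. 3. Put $\Delta_i=N^{2-\alpha}(r_{i+1}-r_i)$. For every $0\le i<n-1$ one can write $r_i=\frac{a_i}{b_i}$ and $r_{i+1}=\frac{c_i}{d_i}$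 with integers $a_i,c_i$ and positive integers $b_i,d_i$ (not necessarily in lowest terms) such that $\Delta_i\le b_i,d_i\le 2\Delta_i$. 4. For every choice as in 3, put $k_i=b_i+d_i$, $M_i=a_i+c_i$ for $0\le i<n-1$, and for $0\le i<n$ $$x_i=\frac1N\sum_{j<i}k_j,\qquad y_i=\frac1{N^\alpha}\sum_{j<i}M_j,\qquad p_i=\frac{N r_i}{N^{\alpha}}.$$ Then there is a convex $C^2$ function $f:\mathbb R\to\mathbb R$ with $f(x_i)=y_i$ and $f'(x_i)=p_i$ for all $0\le i<n$, and $C^{-1}\le f''(x)\le C$ for all $x\in\mathbb{R}$. Moreover, if $N^{(2\alpha-1)/3}\ge 300$, $f$ can be taken such that for some positive integer $m$ the sequence $\left(m f(l/N)\right)_{l=1}^{N}$ is uniformly convex and satisfies $$\left|\{m f(l/N):1\le l\le N\}\cap N^{-\alpha}\mathbb Z\right|\ge C^{-1}N^{(\alpha+1)/3}.$$ -/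

import Mathlib

/-- The fractions in `[N^(α-1)/3, 2N^(α-1)/3]` whose (reduced) denominator is at most
`N^((2-α)/3)`. -/
def fractionSet (N : ℕ) (α : ℝ) : Set ℚ :=
  {q : ℚ | (q : ℝ) ∈ Set.Icc ((N : ℝ) ^ (α - 1) / 3) (2 * (N : ℝ) ^ (α - 1) / 3) ∧
    (q.den : ℝ) ≤ (N : ℝ) ^ ((2 - α) / 3)}

/-- `r 0 < r 1 < ... < r (n - 1)` lists the elements of `S` in increasing order
(the values `r i` with `n ≤ i` play no role). -/
structure IsIncreasingList (S : Set ℚ) (n : ℕ) (r : ℕ → ℚ) : Prop where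
  strictMonoOn : StrictMonoOn r (Set.Iio n)
  image_eq : r '' Set.Iio n = S

/-- `Δ_i = N^(2-α) (r_{i+1} - r_i)`. -/
noncomputable def scaledGap (N : ℕ) (α : ℝ) (r : ℕ → ℚ) (i : ℕ) : ℝ :=
  (N : ℝ) ^ (2 - α) * ((r (i + 1) : ℝ) - (r i : ℝ))

/-- For each pair of neighbours, representations `r_i = a/b` and `r_{i+1} = c/d`, not necessarily
in lowest terms, with `Δ_i ≤ b, d ≤ 2 Δ_i`. The representation of `r_{i+1}` as the right
neighbour of `r_i` need not be the one it has as the left neighbour of `r_{i+2}`. -/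
structure IsChoice (N : ℕ) (α : ℝ) (n : ℕ) (r : ℕ → ℚ)
    (a : ℕ → ℤ) (b : ℕ → ℕ) (c : ℕ → ℤ) (d : ℕ → ℕ) : Prop where
  pos_left : ∀ i, i + 1 < n → 0 < b i
  pos_right : ∀ i, i + 1 < n → 0 < d i
  left_eq : ∀ i, i + 1 < n → r i = (a i : ℚ) / (b i : ℚ)
  right_eq : ∀ i, i + 1 < n → r (i + 1) = (c i : ℚ) / (d i : ℚ)
  left_mem : ∀ i, i + 1 < n →
    (b i : ℝ) ∈ Set.Icc (scaledGap N α r i) (2 * scaledGap N α r i)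
  right_mem : ∀ i, i + 1 < n →
    (d i : ℝ) ∈ Set.Icc (scaledGap N α r i) (2 * scaledGap N α r i)

/-- `x_i = (1/N) ∑_{j < i} k_j` with `k_j = b_j + d_j`. -/
noncomputable def nodeX (N : ℕ) (b d : ℕ → ℕ) (i : ℕ) : ℝ :=
  (1 / (N : ℝ)) * ∑ j ∈ Finset.range i, ((b j + d j : ℕ) : ℝ)

/-- `y_i = N^(-α) ∑_{j < i} M_j` with `M_j = a_j + c_j`. -/
noncomputable def nodeY (N : ℕ) (α : ℝ) (a c : ℕ → ℤ) (i : ℕ) : ℝ :=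
  (∑ j ∈ Finset.range i, ((a j + c j : ℤ) : ℝ)) / (N : ℝ) ^ α

/-- `p_i = N r_i / N^α`. -/
noncomputable def nodeSlope (N : ℕ) (α : ℝ) (r : ℕ → ℚ) (i : ℕ) : ℝ :=
  (N : ℝ) * ((r i : ℝ) / (N : ℝ) ^ α)

/-- A sequence `a_1, ..., a_N` is uniformly convex if its first differences lie in
`[1/(4N), 4/N]` and its second differences in `[1/(4N²), 4/N²]`. -/
structure IsUniformlyConvex (N : ℕ) (a : ℕ → ℝ) : Prop where
  first_diff : ∀ n, 1 ≤ n → n + 1 ≤ N →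
    a (n + 1) - a n ∈ Set.Icc (1 / (4 * (N : ℝ))) (4 / (N : ℝ))
  second_diff : ∀ n, 1 ≤ n → n + 2 ≤ N →
    (a (n + 2) - a (n + 1)) - (a (n + 1) - a n) ∈
      Set.Icc (1 / (4 * (N : ℝ) ^ 2)) (4 / (N : ℝ) ^ 2)

/-- The arithmetic progression `N^(-α) ℤ`. -/
def progression (N : ℕ) (α : ℝ) : Set ℝ :=
  Set.range fun z : ℤ => (N : ℝ) ^ (-α) * (z : ℝ)

/-! Write `Q = N ^ ((2 - α) / 3)`. Distinct fractions with denominators at most `Q` differ by at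
least `1 / Q ^ 2`, so `Δ_i ≥ Q`. Each reduced denominator is therefore at most `Δ_i` and has a
multiple in `[Δ_i, 2 Δ_i]`.

On `[x_i, x_{i+1}]`, of length `(b + d) / N`, the slope must grow by `Δ_i / N`, so the mean of `f''`
is `Δ_i / (b + d)`, between `1/4` and `1/2`. The chord slope is that of the mediant `(a + c) / (b +
d)`: the mean of `p_i` and `p_{i+1}` with weights `b` and `d`, each between `1/3` and `2/3` of the
total. The data thus prescribe two moments of `f''`, with centre of mass well inside the interval.
They are matched by the constant `1/8` plus two nonnegative hats near the ends
(`exists_bump_weights`). The hats vanish at the nodes, so the pieces glue to a `C²` function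
(`exists_interpolant`).

At a node, `x_i` is a multiple of `1 / N` and `y_i` lies in `N^(-α) ℤ`. Nodes with `r_i` in the left
half of the interval satisfy `x_i ≤ 1`, and double counting pairs `(a, b)` shows that there are
enough of them (`mul_sq_le_card_fractions_erase`). -/

/-! ### Spacing of fractions with bounded denominator. -/

/-- Distinct rationals with denominators at most `Q` are at least `1 / Q ^ 2` apart. -/
theorem one_div_sq_le_sub_of_den_le {q q' : ℚ} {Q : ℝ} (h : q < q') (hq : (q.den : ℝ) ≤ Q)
    (hq' : (q'.den : ℝ) ≤ Q) : 1 / Q ^ 2 ≤ (q' : ℝ) - q := by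
  have hd : (0 : ℝ) < q.den := by exact_mod_cast q.pos
  have hd' : (0 : ℝ) < q'.den := by exact_mod_cast q'.pos
  have h1 : q.num * q'.den + 1 ≤ q'.num * q.den := (Rat.lt_iff q q').1 h
  have h2 : (q.num : ℝ) * q'.den + 1 ≤ q'.num * q.den := by exact_mod_cast h1
  have h3 : (q' : ℝ) - q = (q'.num * q.den - q.num * q'.den) / (q.den * q'.den) := by
    rw [Rat.cast_def q, Rat.cast_def q']
    field_simp
  rw [h3]
  have h4 : (q.den : ℝ) * q'.den ≤ Q ^ 2 := by
    rw [sq]; exact mul_le_mul hq hq' hd'.le (hd.le.trans hq)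
  calc 1 / Q ^ 2 ≤ 1 / ((q.den : ℝ) * q'.den) := one_div_le_one_div_of_le (by positivity) h4
    _ ≤ _ := by gcongr; linarith

/-- A set of rationals with denominators at most `Q` in an interval of length `ℓ` has at most
`ℓ * Q ^ 2 + 1` elements. -/
theorem finite_and_ncard_le_of_den_le {S : Set ℚ} {x ℓ Q : ℝ} (hℓ : 0 ≤ ℓ) (hQ : 0 < Q)
    (hS : ∀ q ∈ S, x ≤ q ∧ (q : ℝ) ≤ x + ℓ ∧ (q.den : ℝ) ≤ Q) :
    S.Finite ∧ (S.ncard : ℝ) ≤ ℓ * Q ^ 2 + 1 := by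
  set g : ℚ → ℕ := fun q => ⌊Q ^ 2 * ((q : ℝ) - x)⌋₊ with hg
  set T : Set ℕ := ↑(Finset.range (⌊ℓ * Q ^ 2⌋₊ + 1)) with hT
  have hmaps : Set.MapsTo g S T := by
    intro q hq
    obtain ⟨_, h2, _⟩ := hS q hq
    simp only [hT, Finset.coe_range, Set.mem_Iio, hg, Nat.lt_succ_iff]
    apply Nat.floor_le_floor
    rw [mul_comm]
    gcongr
    linarith
  -- After scaling by `Q ^ 2` distinct elements are at least `1` apart, so their integer parts
  -- differ.
  have hlt : ∀ q ∈ S, ∀ q' ∈ S, q < q' → g q < g q' := by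
    intro q hq q' hq' h
    have h0 : 0 ≤ Q ^ 2 * ((q : ℝ) - x) := mul_nonneg (by positivity) (by linarith [(hS q hq).1])
    have h1 := one_div_sq_le_sub_of_den_le h (hS q hq).2.2 (hS q' hq').2.2
    have h2 : 1 ≤ Q ^ 2 * ((q' : ℝ) - q) := by
      rw [div_le_iff₀ (by positivity)] at h1; linarith
    have h3 : Q ^ 2 * ((q : ℝ) - x) + 1 ≤ Q ^ 2 * ((q' : ℝ) - x) := by nlinarith
    calc g q < ⌊Q ^ 2 * ((q : ℝ) - x)⌋₊ + 1 := Nat.lt_succ_self _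
      _ = ⌊Q ^ 2 * ((q : ℝ) - x) + 1⌋₊ := (Nat.floor_add_one h0).symm
      _ ≤ g q' := Nat.floor_le_floor h3
  have hinj : Set.InjOn g S := by
    intro q hq q' hq' h
    rcases lt_trichotomy q q' with h' | h' | h'
    · exact absurd h (hlt q hq q' hq' h').ne
    · exact h'
    · exact absurd h (hlt q' hq' q hq h').ne'
  have hTf : T.Finite := Finset.finite_toSet _
  refine ⟨Set.Finite.of_injOn hmaps hinj hTf, ?_⟩
  have h1 : S.ncard ≤ ⌊ℓ * Q ^ 2⌋₊ + 1 := by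
    have := Set.ncard_le_ncard_of_injOn g hmaps hinj hTf
    rwa [hT, Set.ncard_coe_finset, Finset.card_range] at this
  calc (S.ncard : ℝ) ≤ ((⌊ℓ * Q ^ 2⌋₊ + 1 : ℕ) : ℝ) := by exact_mod_cast h1
    _ ≤ _ := by push_cast; gcongr; exact Nat.floor_le (by positivity)

/-- A rational can be written with a denominator in `[Δ, 2Δ]` when its reduced denominator
is at most `Δ`. -/
theorem Rat.exists_eq_div_mem_Icc (q : ℚ) {Δ : ℝ} (hq : (q.den : ℝ) ≤ Δ) :
    ∃ (a : ℤ) (b : ℕ), 0 < b ∧ q = (a : ℚ) / (b : ℚ) ∧ (b : ℝ) ∈ Set.Icc Δ (2 * Δ) := by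
  have hd : (0 : ℝ) < q.den := by exact_mod_cast q.pos
  have hΔ : 0 < Δ := hd.trans_le hq
  have ht : 0 < ⌈Δ / q.den⌉₊ := Nat.ceil_pos.2 (by positivity)
  -- The least multiple of `q.den` that reaches `Δ` is below `Δ + q.den ≤ 2 * Δ`.
  refine ⟨⌈Δ / q.den⌉₊ * q.num, ⌈Δ / q.den⌉₊ * q.den, Nat.mul_pos ht q.pos, ?_, ?_, ?_⟩
  · have : ((⌈Δ / q.den⌉₊ : ℕ) : ℚ) ≠ 0 := by exact_mod_cast ht.ne'
    push_cast
    rw [mul_div_mul_left _ _ this, Rat.num_div_den]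
  · have := Nat.le_ceil (Δ / q.den)
    rw [div_le_iff₀ hd] at this
    exact_mod_cast this
  · have h1 := Nat.ceil_lt_add_one (show 0 ≤ Δ / q.den by positivity)
    have h2 : (⌈Δ / q.den⌉₊ : ℝ) * q.den ≤ (Δ / q.den + 1) * q.den := by gcongr
    have h3 : (Δ / q.den + 1) * q.den = Δ + q.den := by field_simp
    push_cast
    linarith

/-! ### Counting numerators for a fixed denominator. -/

/-- The integers in `[L b, 3 L b / 2]`. -/
noncomputable def numerators (L : ℝ) (b : ℕ) : Finset ℤ := Finset.Icc ⌈L * b⌉ ⌊3 / 2 * (L * b)⌋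

theorem mem_numerators {L : ℝ} {b : ℕ} {a : ℤ} :
    a ∈ numerators L b ↔ L * b ≤ a ∧ (a : ℝ) ≤ 3 / 2 * (L * b) := by
  simp [numerators, Int.ceil_le, Int.le_floor]

theorem le_card_numerators (L : ℝ) (b : ℕ) :
    L * b / 2 - 1 ≤ ((numerators L b).card : ℝ) := by
  rw [numerators, Int.card_Icc]
  have h1 := Int.lt_floor_add_one (3 / 2 * (L * b))
  have h2 := Int.ceil_lt_add_one (L * b)
  have h3 : ((⌊3 / 2 * (L * b)⌋ + 1 - ⌈L * b⌉ : ℤ) : ℝ) ≤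
      (((⌊3 / 2 * (L * b)⌋ + 1 - ⌈L * b⌉).toNat : ℤ) : ℝ) := by
    exact_mod_cast Int.self_le_toNat _
  push_cast at h3
  linarith

/-- The usual error term `+ 1` is absorbed: if there is any numerator at all, it is at least `1`, so
`1 ≤ 3 / 2 * (L * b)`. -/
theorem card_numerators_le {L : ℝ} (hL : 0 < L) {b : ℕ} (hb : 0 < b) :
    ((numerators L b).card : ℝ) ≤ 2 * (L * b) := by
  have h0 : 0 < L * b := by positivity
  rcases (numerators L b).eq_empty_or_nonempty with h | ⟨a, ha⟩
  · rw [h]; simpa using h0.le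
  have hne : ⌈L * b⌉ ≤ ⌊3 / 2 * (L * b)⌋ := by
    rw [numerators, Finset.mem_Icc] at ha; omega
  rw [mem_numerators] at ha
  have h1 : (1 : ℝ) ≤ a := by
    have : (0 : ℝ) < a := h0.trans_le ha.1
    exact_mod_cast (by exact_mod_cast this : (0 : ℤ) < a)
  have h2 := Int.floor_le (3 / 2 * (L * b))
  have h3 := Int.le_ceil (L * b)
  have h4 : (((numerators L b).card : ℤ) : ℝ) = ⌊3 / 2 * (L * b)⌋ + 1 - ⌈L * b⌉ := by
    rw [numerators, Int.card_Icc, Int.toNat_of_nonneg (by omega)]; push_cast; ring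
  push_cast at h4
  linarith

/-! ### Piecewise polynomial bumps with explicit antiderivatives. -/

/-- Truncated powers are differentiable. -/
theorem hasDerivAt_max_zero_pow (k : ℕ) (t : ℝ) :
    HasDerivAt (fun t : ℝ => max t 0 ^ (k + 2)) ((k + 2) * max t 0 ^ (k + 1)) t := by
  have hpow : ∀ s, HasDerivAt (fun t : ℝ => t ^ (k + 2)) ((k + 2) * s ^ (k + 1)) s := fun s => by
    simpa using hasDerivAt_pow (k + 2) s
  rcases lt_trichotomy t 0 with h | rfl | h
  · rw [max_eq_right h.le, zero_pow (by omega), mul_zero]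
    refine (hasDerivAt_const t (0 : ℝ)).congr_of_eventuallyEq ?_
    filter_upwards [Iio_mem_nhds h] with s hs
    rw [max_eq_right (le_of_lt hs), zero_pow (by omega)]
  · rw [← hasDerivWithinAt_univ, ← Set.Iic_union_Ici (a := (0 : ℝ))]
    refine HasDerivWithinAt.union ?_ ?_
    · simp only [max_self, zero_pow (Nat.succ_ne_zero k), mul_zero]
      refine (hasDerivWithinAt_const 0 _ (0 : ℝ)).congr_of_mem (fun s hs => ?_) (by simp)
      rw [max_eq_right hs, zero_pow (by omega)]
    · rw [max_self]
      refine (hpow 0).hasDerivWithinAt.congr_of_mem (fun s hs => ?_) (by simp)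
      rw [max_eq_left hs]
  · rw [max_eq_left h.le]
    refine (hpow t).congr_of_eventuallyEq ?_
    filter_upwards [Ioi_mem_nhds h] with s hs
    rw [max_eq_left (le_of_lt hs)]

/-- The hat function on `[0, 4/9]` with integral `1`. -/
noncomputable def hat (t : ℝ) : ℝ :=
  81 / 4 * (max t 0 - 2 * max (t - 2 / 9) 0 + max (t - 4 / 9) 0)

/-- The antiderivative of `hat` vanishing on the negative axis. -/
noncomputable def hatPrimitive (t : ℝ) : ℝ :=
  81 / 8 * (max t 0 ^ 2 - 2 * max (t - 2 / 9) 0 ^ 2 + max (t - 4 / 9) 0 ^ 2)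

/-- The second antiderivative of `hat` vanishing on the negative axis. -/
noncomputable def hatPrimitive₂ (t : ℝ) : ℝ :=
  27 / 8 * (max t 0 ^ 3 - 2 * max (t - 2 / 9) 0 ^ 3 + max (t - 4 / 9) 0 ^ 3)

theorem continuous_hat : Continuous hat := by
  unfold hat; fun_prop

theorem hasDerivAt_hatPrimitive (t : ℝ) : HasDerivAt hatPrimitive (hat t) t := by
  have h := fun c : ℝ => (hasDerivAt_max_zero_pow 0 (t - c)).comp_sub_const t c
  have := (((hasDerivAt_max_zero_pow 0 t).sub ((h (2 / 9)).const_mul 2)).add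
    (h (4 / 9))).const_mul (81 / 8)
  refine this.congr_deriv ?_
  simp only [hat]; push_cast; ring

theorem hasDerivAt_hatPrimitive₂ (t : ℝ) : HasDerivAt hatPrimitive₂ (hatPrimitive t) t := by
  have h := fun c : ℝ => (hasDerivAt_max_zero_pow 1 (t - c)).comp_sub_const t c
  have := (((hasDerivAt_max_zero_pow 1 t).sub ((h (2 / 9)).const_mul 2)).add
    (h (4 / 9))).const_mul (27 / 8)
  refine this.congr_deriv ?_
  simp only [hatPrimitive]; push_cast; ring

theorem hat_nonneg (t : ℝ) : 0 ≤ hat t := by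
  simp only [hat, max_def]; split_ifs <;> linarith

theorem hat_le (t : ℝ) : hat t ≤ 9 / 2 := by
  simp only [hat, max_def]; split_ifs <;> linarith

theorem hat_of_nonpos {t : ℝ} (ht : t ≤ 0) : hat t = 0 := by
  simp [hat, ht, max_eq_right (show t - 2 / 9 ≤ 0 by linarith),
    max_eq_right (show t - 4 / 9 ≤ 0 by linarith)]

theorem hatPrimitive_of_nonpos {t : ℝ} (ht : t ≤ 0) : hatPrimitive t = 0 := by
  simp [hatPrimitive, ht, max_eq_right (show t - 2 / 9 ≤ 0 by linarith),
    max_eq_right (show t - 4 / 9 ≤ 0 by linarith)]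

theorem hatPrimitive₂_of_nonpos {t : ℝ} (ht : t ≤ 0) : hatPrimitive₂ t = 0 := by
  simp [hatPrimitive₂, ht, max_eq_right (show t - 2 / 9 ≤ 0 by linarith),
    max_eq_right (show t - 4 / 9 ≤ 0 by linarith)]

theorem hat_of_one_le {t : ℝ} (ht : 1 ≤ t) : hat t = 0 := by
  rw [hat, max_eq_left (by linarith), max_eq_left (by linarith), max_eq_left (by linarith)]; ring

theorem hatPrimitive_of_one_le {t : ℝ} (ht : 1 ≤ t) : hatPrimitive t = 1 := by
  rw [hatPrimitive, max_eq_left (by linarith), max_eq_left (by linarith),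
    max_eq_left (by linarith)]; ring

/-- The shift `2 / 9` is the centre of mass of the hat. -/
theorem hatPrimitive₂_of_one_le {t : ℝ} (ht : 1 ≤ t) : hatPrimitive₂ t = t - 2 / 9 := by
  rw [hatPrimitive₂, max_eq_left (by linarith), max_eq_left (by linarith),
    max_eq_left (by linarith)]; ring

/-- `A` times a hat near `0` plus `B` times a hat near `1`. -/
noncomputable def bump (A B t : ℝ) : ℝ := A * hat t + B * hat (1 - t)

/-- The antiderivative of `bump A B` vanishing on the negative axis. -/
noncomputable def bumpPrimitive (A B t : ℝ) : ℝ :=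
  A * hatPrimitive t + B * (1 - hatPrimitive (1 - t))

/-- The second antiderivative of `bump A B` vanishing on the negative axis. -/
noncomputable def bumpPrimitive₂ (A B t : ℝ) : ℝ :=
  A * hatPrimitive₂ t + B * (hatPrimitive₂ (1 - t) + t - 7 / 9)

theorem continuous_bump (A B : ℝ) : Continuous (bump A B) := by
  have := continuous_hat
  unfold bump; fun_prop

theorem hasDerivAt_bumpPrimitive (A B t : ℝ) :
    HasDerivAt (bumpPrimitive A B) (bump A B t) t := by
  have h := (hasDerivAt_hatPrimitive (1 - t)).comp_const_sub 1 t
  refine (((hasDerivAt_hatPrimitive t).const_mul A).add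
    (((hasDerivAt_const t (1 : ℝ)).sub h).const_mul B)).congr_deriv ?_
  rw [bump]; ring

theorem hasDerivAt_bumpPrimitive₂ (A B t : ℝ) :
    HasDerivAt (bumpPrimitive₂ A B) (bumpPrimitive A B t) t := by
  have h := (hasDerivAt_hatPrimitive₂ (1 - t)).comp_const_sub 1 t
  refine (((hasDerivAt_hatPrimitive₂ t).const_mul A).add
    (((h.add (hasDerivAt_id t)).sub_const (7 / 9)).const_mul B)).congr_deriv ?_
  rw [bumpPrimitive]; ring

theorem bump_of_nonpos {A B t : ℝ} (ht : t ≤ 0) : bump A B t = 0 := by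
  rw [bump, hat_of_nonpos ht, hat_of_one_le (by linarith)]; ring

theorem bumpPrimitive_of_nonpos {A B t : ℝ} (ht : t ≤ 0) : bumpPrimitive A B t = 0 := by
  rw [bumpPrimitive, hatPrimitive_of_nonpos ht, hatPrimitive_of_one_le (by linarith)]; ring

/-- This fixes the constant in `bumpPrimitive₂`: for `t ≤ 0` the reflected hat contributes
`hatPrimitive₂ (1 - t) = 7 / 9 - t`. -/
theorem bumpPrimitive₂_of_nonpos {A B t : ℝ} (ht : t ≤ 0) : bumpPrimitive₂ A B t = 0 := by
  rw [bumpPrimitive₂, hatPrimitive₂_of_nonpos ht, hatPrimitive₂_of_one_le (by linarith)]; ring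

theorem bump_of_one_le {A B t : ℝ} (ht : 1 ≤ t) : bump A B t = 0 := by
  rw [bump, hat_of_one_le ht, hat_of_nonpos (by linarith)]; ring

theorem bumpPrimitive_of_one_le {A B t : ℝ} (ht : 1 ≤ t) : bumpPrimitive A B t = A + B := by
  rw [bumpPrimitive, hatPrimitive_of_one_le ht, hatPrimitive_of_nonpos (by linarith)]; ring

theorem bumpPrimitive₂_of_one_le {A B t : ℝ} (ht : 1 ≤ t) :
    bumpPrimitive₂ A B t = A * (t - 2 / 9) + B * (t - 7 / 9) := by
  rw [bumpPrimitive₂, hatPrimitive₂_of_one_le ht, hatPrimitive₂_of_nonpos (by linarith)]; ring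

/-- The bound `15 / 8` leaves room for the background `1 / 8` below the target `2`; the hats give `9
/ 2 * (3 / 8) = 27 / 16`. -/
theorem bump_mem_Icc {A B : ℝ} (hA : 0 ≤ A) (hB : 0 ≤ B) (hAB : A + B ≤ 3 / 8) (t : ℝ) :
    bump A B t ∈ Set.Icc 0 (15 / 8) := by
  have h1 := hat_nonneg t
  have h2 := hat_nonneg (1 - t)
  have h3 := hat_le t
  have h4 := hat_le (1 - t)
  refine ⟨by unfold bump; positivity, ?_⟩
  unfold bump
  nlinarith [mul_le_mul_of_nonneg_left h3 hA, mul_le_mul_of_nonneg_left h4 hB]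

/-! ### Hermite interpolation with controlled second derivative. -/

/-- Data `(x i, y i, p i)`, `i ≤ K`, whose increments are those of a function with second
derivative `1/8` plus a scaled bump on each `[x i, x (i + 1)]`, are interpolated to first order by
a function with second derivative between `1/8` and `2`. -/
theorem exists_interpolant (x y p A B : ℕ → ℝ) (K : ℕ)
    (hx : ∀ i < K, x i < x (i + 1)) (hA : ∀ i < K, 0 ≤ A i) (hB : ∀ i < K, 0 ≤ B i)
    (hAB : ∀ i < K, A i + B i ≤ 3 / 8)
    (hp : ∀ i < K, p (i + 1) = p i + (x (i + 1) - x i) * (1 / 8 + A i + B i))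
    (hy : ∀ i < K, y (i + 1) = y i + (x (i + 1) - x i) * p i +
      (x (i + 1) - x i) ^ 2 * (1 / 16 + 7 / 9 * A i + 2 / 9 * B i)) :
    ∃ f f' f'' : ℝ → ℝ, (∀ t, HasDerivAt f (f' t) t) ∧ (∀ t, HasDerivAt f' (f'' t) t) ∧
      Continuous f'' ∧ (∀ i ≤ K, f (x i) = y i) ∧ (∀ i ≤ K, f' (x i) = p i) ∧
      (∀ t, f'' t ∈ Set.Icc (1 / 8) 2) ∧
      (∀ t, x K ≤ t → f t = y K + p K * (t - x K) + (t - x K) ^ 2 / 16) ∧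
      (∀ t, x K ≤ t → f' t = p K + (t - x K) / 8) ∧ (∀ t, x K ≤ t → f'' t = 1 / 8) := by
  -- The last three conclusions carry the induction: beyond the last node `f` is the parabola with
  -- second derivative `1 / 8`, so the next interval is handled by adding one bump, which leaves
  -- everything to its left unchanged.
  induction K with
  | zero =>
    refine ⟨fun t => y 0 + p 0 * (t - x 0) + (t - x 0) ^ 2 / 16, fun t => p 0 + (t - x 0) / 8,
      fun _ => 1 / 8, fun t => ?_, fun t => ?_, continuous_const, ?_, ?_, ?_, fun _ _ => rfl,
      fun _ _ => rfl, fun _ _ => rfl⟩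
    · have h := (hasDerivAt_id t).sub_const (x 0)
      refine (((h.const_mul (p 0)).const_add (y 0)).add ((h.pow 2).div_const 16)).congr_deriv ?_
      simp; ring
    · exact (((hasDerivAt_id t).sub_const (x 0)).div_const 8).const_add (p 0)
    · intro i hi; obtain rfl : i = 0 := by omega
      simp
    · intro i hi; obtain rfl : i = 0 := by omega
      simp
    · intro t; constructor <;> norm_num
  | succ K ih =>
    obtain ⟨f, f', f'', hf, hf', hc, hfy, hfp, hb, e, e', e''⟩ :=
      ih (fun i hi => hx i (by omega)) (fun i hi => hA i (by omega)) (fun i hi => hB i (by omega))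
        (fun i hi => hAB i (by omega)) (fun i hi => hp i (by omega)) (fun i hi => hy i (by omega))
    have hmono : ∀ i ≤ K, x i ≤ x K := fun i hi =>
      monotoneOn_of_le_succ Set.ordConnected_Iic (fun j _ _ hj => (hx j (by
        rw [Nat.succ_eq_succ, Set.mem_Iic] at hj; omega)).le) (show i ∈ Set.Iic K from hi)
        (Set.mem_Iic.2 le_rfl) hi
    set h := x (K + 1) - x K with hh
    have hpos : 0 < h := sub_pos.2 (hx K (by omega))
    have hlin : ∀ t, HasDerivAt (fun t => (t - x K) / h) (1 / h) t := fun t =>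
      ((hasDerivAt_id t).sub_const (x K)).div_const h
    have hright : ∀ t, x (K + 1) ≤ t → x K ≤ t ∧ 1 ≤ (t - x K) / h := fun t ht =>
      ⟨by linarith, by rw [le_div_iff₀ hpos]; linarith⟩
    have hleft : ∀ t, t ≤ x K → (t - x K) / h ≤ 0 := fun t ht =>
      div_nonpos_of_nonpos_of_nonneg (by linarith) hpos.le
    have E : ∀ t, x (K + 1) ≤ t →
        f t + h ^ 2 * bumpPrimitive₂ (A K) (B K) ((t - x K) / h) =
          y (K + 1) + p (K + 1) * (t - x (K + 1)) + (t - x (K + 1)) ^ 2 / 16 := by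
      intro t ht
      obtain ⟨h1, h2⟩ := hright t ht
      have h3 : x (K + 1) = x K + h := by rw [hh]; ring
      rw [e t h1, bumpPrimitive₂_of_one_le h2, hy K (by omega), hp K (by omega), ← hh, h3]
      field_simp
      ring
    have E' : ∀ t, x (K + 1) ≤ t →
        f' t + h * bumpPrimitive (A K) (B K) ((t - x K) / h) =
          p (K + 1) + (t - x (K + 1)) / 8 := by
      intro t ht
      obtain ⟨h1, h2⟩ := hright t ht
      have h3 : x (K + 1) = x K + h := by rw [hh]; ring
      rw [e' t h1, bumpPrimitive_of_one_le h2, hp K (by omega), ← hh, h3]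
      ring
    refine ⟨fun t => f t + h ^ 2 * bumpPrimitive₂ (A K) (B K) ((t - x K) / h),
      fun t => f' t + h * bumpPrimitive (A K) (B K) ((t - x K) / h),
      fun t => f'' t + bump (A K) (B K) ((t - x K) / h), fun t => ?_, fun t => ?_, ?_, ?_, ?_, ?_,
      E, E', ?_⟩
    · refine ((hf t).add (((hasDerivAt_bumpPrimitive₂ (A K) (B K) _).comp t
        (hlin t)).const_mul (h ^ 2))).congr_deriv ?_
      field_simp
    · refine ((hf' t).add (((hasDerivAt_bumpPrimitive (A K) (B K) _).comp t
        (hlin t)).const_mul h)).congr_deriv ?_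
      field_simp
    · exact hc.add ((continuous_bump _ _).comp (by fun_prop))
    · intro i hi
      rcases Nat.lt_or_eq_of_le hi with hi | rfl
      · simp only [bumpPrimitive₂_of_nonpos (hleft _ (hmono i (by omega))), hfy i (by omega),
          mul_zero, add_zero]
      · simpa using E _ le_rfl
    · intro i hi
      rcases Nat.lt_or_eq_of_le hi with hi | rfl
      · simp only [bumpPrimitive_of_nonpos (hleft _ (hmono i (by omega))), hfp i (by omega),
          mul_zero, add_zero]
      · simpa using E' _ le_rfl
    · intro t
      rcases le_total t (x K) with ht | ht
      · simpa only [bump_of_nonpos (hleft t ht), add_zero] using hb t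
      · obtain ⟨h1, h2⟩ := bump_mem_Icc (hA K (by omega)) (hB K (by omega)) (hAB K (by omega))
          ((t - x K) / h)
        simp only [e'' t ht]
        constructor <;> linarith
    · intro t ht
      obtain ⟨h1, h2⟩ := hright t ht
      simp only [e'' t h1, bump_of_one_le h2, add_zero]

/-- A second difference is a value of the second derivative times the squared step. -/
theorem exists_second_difference_eq {f f' f'' : ℝ → ℝ} (hf : ∀ t, HasDerivAt f (f' t) t)
    (hf' : ∀ t, HasDerivAt f' (f'' t) t) (x : ℝ) {η : ℝ} (hη : 0 < η) :
    ∃ ξ, (f (x + η + η) - f (x + η)) - (f (x + η) - f x) = η ^ 2 * f'' ξ := by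
  -- The mean value theorem is applied to the first difference as a function of `t`, and then to
  -- `f'`.
  have hF : ∀ t, HasDerivAt (fun t => f (t + η) - f t) (f' (t + η) - f' t) t := fun t =>
    ((hf (t + η)).comp_add_const t η).sub (hf t)
  obtain ⟨c, -, h1⟩ := exists_hasDerivAt_eq_slope _ _ (show x < x + η by linarith)
    (fun t _ => (hF t).continuousAt.continuousWithinAt) (fun t _ => hF t)
  obtain ⟨ξ, -, h2⟩ := exists_hasDerivAt_eq_slope _ _ (show c < c + η by linarith)
    (fun t _ => (hf' t).continuousAt.continuousWithinAt) (fun t _ => hf' t)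
  refine ⟨ξ, ?_⟩
  rw [add_sub_cancel_left, eq_div_iff hη.ne'] at h1 h2
  rw [sq, mul_assoc, mul_comm η (f'' ξ), h2, mul_comm, h1]

/-! ### Lower bound for the number of fractions by double counting. -/

theorem sum_Icc_one_half_mul_sub_one (L : ℝ) (m : ℕ) :
    ∑ b ∈ Finset.Icc 1 m, (L * b / 2 - 1) = L * (m * (m + 1)) / 4 - m := by
  induction m with
  | zero => simp
  | succ m ih => rw [Finset.sum_Icc_succ_top (by omega), ih]; push_cast; ring

/-- The fractions `a / b` in `[L, 3 L / 2]` with `1 ≤ b ≤ m`. -/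
noncomputable def fractions (L : ℝ) (m : ℕ) : Finset ℚ :=
  ((Finset.Icc 1 m).sigma (numerators L)).image fun p => (p.2 : ℚ) / (p.1 : ℚ)

theorem mem_fractions {L : ℝ} {m : ℕ} {q : ℚ} (hq : q ∈ fractions L m) :
    L ≤ q ∧ (q : ℝ) ≤ 3 / 2 * L ∧ q.den ≤ m := by
  simp only [fractions, Finset.mem_image, Finset.mem_sigma, Finset.mem_Icc, mem_numerators] at hq
  obtain ⟨⟨b, a⟩, ⟨⟨hb, hbm⟩, h1, h2⟩, rfl⟩ := hq
  dsimp only at *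
  have hb' : (0 : ℝ) < b := by exact_mod_cast hb
  refine ⟨?_, ?_, ?_⟩
  · push_cast; rwa [le_div_iff₀ hb']
  · push_cast; rw [div_le_iff₀ hb']; linarith
  · have h3 : (((a : ℚ) / (b : ℚ)).den : ℤ) ∣ b := by
      simpa only [Rat.divInt_eq_div, Int.cast_natCast] using Rat.den_dvd a b
    exact (Nat.le_of_dvd (by omega) (Int.natCast_dvd_natCast.1 h3)).trans hbm

/-- The number of pairs `(a, b)` with `a / b = q` and `1 ≤ b ≤ m` is at most `m / q.den`. -/
theorem card_filter_div_eq_le (L : ℝ) (m : ℕ) (q : ℚ) :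
    ((((Finset.Icc 1 m).sigma (numerators L)).filter
      fun p => (p.2 : ℚ) / (p.1 : ℚ) = q).card : ℝ) ≤ m / q.den := by
  have h : (((Finset.Icc 1 m).sigma (numerators L)).filter
      fun p => (p.2 : ℚ) / (p.1 : ℚ) = q).card ≤
      ((Finset.Ioc 0 m).filter fun b => q.den ∣ b).card := by
    refine Finset.card_le_card_of_injOn (fun p => p.1) ?_ ?_
    · rintro ⟨b, a⟩ hp
      simp only [Finset.coe_filter, Finset.mem_sigma, Finset.mem_Icc, Set.mem_ofPred_eq] at hp
      simp only [Finset.coe_filter, Finset.mem_Ioc, Set.mem_ofPred_eq]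
      refine ⟨⟨by omega, by omega⟩, ?_⟩
      have h3 : (((a : ℚ) / (b : ℚ)).den : ℤ) ∣ b := by
        simpa only [Rat.divInt_eq_div, Int.cast_natCast] using Rat.den_dvd a b
      rw [← hp.2]
      exact Int.natCast_dvd_natCast.1 h3
    · rintro ⟨b, a⟩ hp ⟨b', a'⟩ hp' hbb
      simp only [Finset.coe_filter, Finset.mem_sigma, Finset.mem_Icc, Set.mem_ofPred_eq] at hp hp'
      obtain rfl : b = b' := hbb
      have hb : (b : ℚ) ≠ 0 := by have := hp.1.1.1; positivity
      have h4 := hp.2.trans hp'.2.symm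
      rw [div_left_inj' hb] at h4
      obtain rfl : a = a' := by exact_mod_cast h4
      rfl
  rw [Nat.Ioc_filter_dvd_card_eq_div] at h
  calc _ ≤ ((m / q.den : ℕ) : ℝ) := by exact_mod_cast h
    _ ≤ _ := Nat.cast_div_le

/-- A fraction of given reduced denominator is determined by its numerator. -/
theorem card_filter_den_eq_le {L : ℝ} (hL : 0 < L) {m e : ℕ} (he : 0 < e) {S : Finset ℚ}
    (hS : S ⊆ fractions L m) : ((S.filter fun q => q.den = e).card : ℝ) ≤ 2 * (L * e) := by
  refine le_trans ?_ (card_numerators_le hL he)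
  have h : (S.filter fun q => q.den = e).card ≤ (numerators L e).card := by
    refine Finset.card_le_card_of_injOn Rat.num ?_ ?_
    · intro q hq
      simp only [Finset.coe_filter, Set.mem_ofPred_eq] at hq
      obtain ⟨h1, h2, -⟩ := mem_fractions (hS hq.1)
      rw [Finset.mem_coe, mem_numerators, ← hq.2]
      have hd : (0 : ℝ) < q.den := by exact_mod_cast q.pos
      rw [Rat.cast_def, le_div_iff₀ hd] at h1
      rw [Rat.cast_def, div_le_iff₀ hd] at h2
      exact ⟨h1, by linarith⟩
    · intro q hq q' hq' h
      simp only [Finset.coe_filter, Set.mem_ofPred_eq] at hq hq'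
      exact Rat.ext h (hq.2.trans hq'.2.symm)
  exact_mod_cast h

/-- Bounds the multiplicities in the count of pairs. Each denominator `e ≤ m / 20` contributes at
most `2 * (L * e) * (m / e) = 2 * L * m`, hence `L * m ^ 2 / 10` in total, less than the main term
`L * m ^ 2 / 4`. A fraction of larger denominator has weight at most `20`. -/
theorem sum_div_den_le {L : ℝ} (hL : 0 < L) {m : ℕ} {S : Finset ℚ} (hS : S ⊆ fractions L m) :
    ∑ q ∈ S, (m : ℝ) / q.den ≤ L * m ^ 2 / 10 + 20 * S.card := by
  rw [← Finset.sum_filter_add_sum_filter_not S fun q => 20 * q.den ≤ m]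
  refine add_le_add ?_ ?_
  · rw [← Finset.sum_fiberwise_of_maps_to (t := Finset.Icc 1 (m / 20)) (g := Rat.den)
      (fun q hq => by
        have h1 := (Finset.mem_filter.1 hq).2
        have h2 := q.pos
        rw [Finset.mem_Icc]; omega)]
    have h : ∀ e ∈ Finset.Icc 1 (m / 20),
        ∑ q ∈ (S.filter fun q => 20 * q.den ≤ m).filter (fun q => q.den = e), (m : ℝ) / q.den
          ≤ 2 * L * m := by
      intro e he
      have he0 : 0 < e := (Finset.mem_Icc.1 he).1
      have he' : (0 : ℝ) < e := by exact_mod_cast he0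
      rw [Finset.sum_congr rfl (g := fun _ => (m : ℝ) / e)
        (fun q hq => by rw [(Finset.mem_filter.1 hq).2]), Finset.sum_const, nsmul_eq_mul]
      calc _ ≤ 2 * (L * e) * ((m : ℝ) / e) := by
            gcongr
            exact card_filter_den_eq_le hL he0 ((Finset.filter_subset _ _).trans hS)
        _ = 2 * L * m := by field_simp
    refine (Finset.sum_le_sum h).trans ?_
    rw [Finset.sum_const, nsmul_eq_mul, Nat.card_Icc, Nat.add_sub_cancel]
    have h2 : ((m / 20 : ℕ) : ℝ) ≤ m / 20 := by
      simpa using Nat.cast_div_le (α := ℝ) (m := m) (n := 20)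
    calc ((m / 20 : ℕ) : ℝ) * (2 * L * m) ≤ m / 20 * (2 * L * m) := by gcongr
      _ = _ := by ring
  · refine (Finset.sum_le_card_nsmul _ _ 20 fun q hq => ?_).trans ?_
    · have h1 := (Finset.mem_filter.1 hq).2
      have hd : (0 : ℝ) < q.den := by exact_mod_cast q.pos
      rw [div_le_iff₀ hd]
      exact_mod_cast (not_le.1 h1).le
    · rw [nsmul_eq_mul, mul_comm]
      gcongr
      exact Finset.filter_subset _ _

/-- A positive proportion of the pairs `(a, b)` with `b ≤ Q` and `a / b ∈ [L, 3 L / 2]` give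
distinct fractions, even when one fraction `q₀` is left out. -/
theorem mul_sq_le_card_fractions_erase {L Q : ℝ} (hL : 0 < L) (hQ : 1 ≤ Q) (hLQ : 100 ≤ L * Q)
    (q₀ : ℚ) : L * Q ^ 2 ≤ 310 * (((fractions L ⌊Q⌋₊).erase q₀).card : ℝ) := by
  set m := ⌊Q⌋₊ with hm
  have hm1 : (1 : ℝ) ≤ m := by exact_mod_cast (Nat.one_le_floor_iff Q).2 hQ
  have hmQ : Q ≤ m + 1 := (Nat.lt_floor_add_one Q).le
  set P := (Finset.Icc 1 m).sigma (numerators L) with hP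
  have h1 : L * (m * (m + 1)) / 4 - m ≤ (P.card : ℝ) := by
    rw [hP, Finset.card_sigma, ← sum_Icc_one_half_mul_sub_one]
    push_cast
    exact Finset.sum_le_sum fun b _ => le_card_numerators L b
  have h2 : (P.card : ℝ) ≤ ∑ q ∈ fractions L m, (m : ℝ) / q.den := by
    rw [Finset.card_eq_sum_card_image (fun p : (_ : ℕ) × ℤ => (p.2 : ℚ) / (p.1 : ℚ)) P]
    push_cast
    exact Finset.sum_le_sum fun q _ => card_filter_div_eq_le L m q
  have h3 : ∑ q ∈ fractions L m, (m : ℝ) / q.den ≤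
      ∑ q ∈ (fractions L m).erase q₀, (m : ℝ) / q.den + m := by
    have hle : (m : ℝ) / q₀.den ≤ m :=
      div_le_self (by positivity) (by exact_mod_cast q₀.pos)
    by_cases hq : q₀ ∈ fractions L m
    · rw [← Finset.sum_erase_add _ _ hq]; gcongr
    · rw [Finset.erase_eq_of_notMem hq]; linarith
  have h4 := sum_div_den_le hL (Finset.erase_subset q₀ (fractions L m))
  -- The linear losses, `m` from rounding and `m` from the omitted fraction, are at most `1 / 50` of
  -- `L * m * (m + 1)`. What remains is `1/4 - 1/10 - 1/50 = 13/100` of it, and `2 * 20 / (13/100) <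
  -- 310`.
  have h5 : 100 ≤ L * (m + 1) := hLQ.trans (by gcongr)
  have h6 : 100 * (m : ℝ) ≤ L * (m + 1) * m := by gcongr
  have h7 : L * Q ^ 2 ≤ L * (m + 1) ^ 2 := by gcongr
  have h8 : L * (m + 1 : ℝ) ^ 2 ≤ 2 * (L * (m * (m + 1))) := by
    have : 0 ≤ L * (m + 1) * (m - 1) := mul_nonneg (by positivity) (by linarith)
    nlinarith
  have h9 : L * (m : ℝ) ^ 2 ≤ L * (m * (m + 1)) := by
    have : 0 ≤ L * m := by positivity
    nlinarith
  linarith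

/-! ### Moments prescribed by the node data. -/

/-- The two equations form a linear system for `A` and `B` with a unique solution, in which `B` is
`A` with `b` and `d` exchanged. Only nonnegativity uses the range of `b` and `d`. -/
theorem exists_bump_weights {b d Δ : ℝ} (hΔ : 0 < Δ) (hb : b ∈ Set.Icc Δ (2 * Δ))
    (hd : d ∈ Set.Icc Δ (2 * Δ)) :
    ∃ A B : ℝ, 0 ≤ A ∧ 0 ≤ B ∧ A + B ≤ 3 / 8 ∧ 1 / 8 + A + B = Δ / (b + d) ∧
      1 / 16 + 7 / 9 * A + 2 / 9 * B = d * Δ / (b + d) ^ 2 := by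
  have key : ∀ b d : ℝ, b ∈ Set.Icc Δ (2 * Δ) → d ∈ Set.Icc Δ (2 * Δ) →
      0 ≤ 9 / 5 * (d * Δ / (b + d) ^ 2 - 2 / 9 * (Δ / (b + d)) - 5 / 144) := by
    rintro b d ⟨hb1, hb2⟩ ⟨hd1, hd2⟩
    have hk : 0 < b + d := by linarith
    have h : d * Δ / (b + d) ^ 2 - 2 / 9 * (Δ / (b + d)) - 5 / 144 =
        (144 * (d * Δ) - 32 * (Δ * (b + d)) - 5 * (b + d) ^ 2) / (144 * (b + d) ^ 2) := by
      field_simp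
      ring
    rw [h]
    have hle : b + d ≤ d + 2 * Δ := by linarith
    have h1 : (b + d) ^ 2 ≤ (d + 2 * Δ) ^ 2 := pow_le_pow_left₀ hk.le hle 2
    have h2 : Δ * (b + d) ≤ Δ * (d + 2 * Δ) :=
      mul_le_mul_of_nonneg_left hle hΔ.le
    -- The worst case is `b = 2 * Δ`, where the numerator equals this product plus `3 * Δ ^ 2`.
    have h3 : 0 ≤ (d - Δ) * (87 * Δ - 5 * d) := mul_nonneg (by linarith) (by linarith)
    have h4 : 0 ≤ 144 * (d * Δ) - 32 * (Δ * (b + d)) - 5 * (b + d) ^ 2 := by nlinarith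
    positivity
  have hk : 0 < b + d := by linarith [hb.1, hd.1]
  refine ⟨_, _, key b d hb hd, key d b hd hb, ?_, ?_, ?_⟩
  · have h : Δ / (b + d) ≤ 1 / 2 := by
      rw [div_le_iff₀ hk]; linarith [hb.1, hd.1]
    have h2 : d * Δ / (b + d) ^ 2 + b * Δ / (b + d) ^ 2 = Δ / (b + d) := by
      field_simp
      ring
    rw [add_comm d b]
    linarith
  · rw [add_comm d b]; field_simp; ring
  · rw [add_comm d b]; field_simp; ring

theorem rpow_mul_rpow_two_sub {N : ℕ} (hN : 1 ≤ N) (α : ℝ) :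
    (N : ℝ) ^ (2 - α) * (N : ℝ) ^ α = (N : ℝ) ^ 2 := by
  rw [← Real.rpow_add (by positivity), sub_add_cancel, Real.rpow_two]

section Interpolation

variable {N : ℕ} {α : ℝ} {n : ℕ} {r : ℕ → ℚ} {a : ℕ → ℤ} {b : ℕ → ℕ} {c : ℕ → ℤ} {d : ℕ → ℕ}

theorem nodeX_succ (N : ℕ) (b d : ℕ → ℕ) (i : ℕ) :
    nodeX N b d (i + 1) - nodeX N b d i = ((b i : ℝ) + d i) / N := by
  simp only [nodeX, Finset.sum_range_succ]; push_cast; ring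

theorem nodeY_succ (N : ℕ) (α : ℝ) (a c : ℕ → ℤ) (i : ℕ) :
    nodeY N α a c (i + 1) = nodeY N α a c i + ((a i : ℝ) + c i) / (N : ℝ) ^ α := by
  simp only [nodeY, Finset.sum_range_succ]; push_cast; ring

theorem IsChoice.left_eq_mul (h : IsChoice N α n r a b c d) {i : ℕ} (hi : i + 1 < n) :
    (a i : ℝ) = r i * b i := by
  have : (b i : ℚ) ≠ 0 := by exact_mod_cast (h.pos_left i hi).ne'
  have h1 : (a i : ℚ) = r i * b i := by rw [h.left_eq i hi]; field_simp
  exact_mod_cast h1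

theorem IsChoice.right_eq_mul (h : IsChoice N α n r a b c d) {i : ℕ} (hi : i + 1 < n) :
    (c i : ℝ) = r (i + 1) * d i := by
  have : (d i : ℚ) ≠ 0 := by exact_mod_cast (h.pos_right i hi).ne'
  have h1 : (c i : ℚ) = r (i + 1) * d i := by rw [h.right_eq i hi]; field_simp
  exact_mod_cast h1

/-- The data of a choice are interpolated by a function with second derivative in `[1/8, 2]`. -/
theorem IsChoice.exists_interpolant (hN : 1 ≤ N) (h : IsChoice N α n r a b c d)
    (hgap : ∀ i, i + 1 < n → 0 < scaledGap N α r i) :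
    ∃ f f' f'' : ℝ → ℝ, (∀ t, HasDerivAt f (f' t) t) ∧ (∀ t, HasDerivAt f' (f'' t) t) ∧
      Continuous f'' ∧ (∀ i < n, f (nodeX N b d i) = nodeY N α a c i) ∧
      (∀ i < n, f' (nodeX N b d i) = nodeSlope N α r i) ∧ (∀ t, f'' t ∈ Set.Icc (1 / 8) 2) ∧
      ∀ t, nodeX N b d (n - 1) ≤ t →
        f' t = nodeSlope N α r (n - 1) + (t - nodeX N b d (n - 1)) / 8 := by
  have hN0 : (0 : ℝ) < N := by exact_mod_cast hN
  have hX : 0 < (N : ℝ) ^ α := by positivity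
  have hY : 0 < (N : ℝ) ^ (2 - α) := by positivity
  have hXY := rpow_mul_rpow_two_sub hN α
  have hw : ∀ i, ∃ A B : ℝ, i + 1 < n → 0 ≤ A ∧ 0 ≤ B ∧ A + B ≤ 3 / 8 ∧
      1 / 8 + A + B = scaledGap N α r i / (b i + d i) ∧
      1 / 16 + 7 / 9 * A + 2 / 9 * B = d i * scaledGap N α r i / (b i + d i) ^ 2 := by
    intro i
    by_cases hi : i + 1 < n
    · obtain ⟨A, B, hAB⟩ := exists_bump_weights (hgap i hi) (h.left_mem i hi) (h.right_mem i hi)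
      exact ⟨A, B, fun _ => hAB⟩
    · exact ⟨0, 0, fun hi' => absurd hi' hi⟩
  choose A B hAB using hw
  have hr : ∀ i, (r (i + 1) : ℝ) = r i + scaledGap N α r i / (N : ℝ) ^ (2 - α) := by
    intro i; rw [scaledGap]; field_simp; ring
  have hk : ∀ i, i + 1 < n → (0 : ℝ) < b i + d i := fun i hi => by
    linarith [(h.left_mem i hi).1, (h.right_mem i hi).1, hgap i hi]
  obtain ⟨f, f', f'', hf, hf', hc, hy, hp, hb, -, he, -⟩ :=
    _root_.exists_interpolant (nodeX N b d) (nodeY N α a c) (nodeSlope N α r) A B (n - 1)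
      (fun i hi => by
        have := div_pos (hk i (by omega)) hN0
        rw [← nodeX_succ] at this; linarith)
      (fun i hi => (hAB i (by omega)).1) (fun i hi => (hAB i (by omega)).2.1)
      (fun i hi => (hAB i (by omega)).2.2.1)
      -- Slope increment: both sides exceed `p i` by `Δ_i / N`, since `N ^ (2 - α) * N ^ α = N ^ 2`.
      (fun i hi => by
        have hki := hk i (by omega)
        rw [(hAB i (by omega)).2.2.2.1, nodeX_succ, nodeSlope, nodeSlope, hr]
        field_simp
        rw [← hXY]; ring)
      -- Height increment: `a + c = r_i (b + d) + (r_{i+1} - r_i) d`, whose last term gives `d Δ_i /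
      -- N ^ 2` after division by `N ^ α`.
      (fun i hi => by
        have hki := hk i (by omega)
        rw [(hAB i (by omega)).2.2.2.2, nodeX_succ, nodeSlope, nodeY_succ,
          h.left_eq_mul (by omega), h.right_eq_mul (by omega), hr]
        field_simp
        rw [← hXY]; ring)
  exact ⟨f, f', f'', hf, hf', hc, fun i hi => hy i (by omega), fun i hi => hp i (by omega), hb, he⟩

end Interpolation

/-! ### Uniform convexity of the samples. -/

/-- Sampling `2 f` gives a uniformly convex sequence when `f' ∈ [1/8, 2]` on `[0, 1]` and
`f'' ∈ [1/8, 2]`. -/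
theorem isUniformlyConvex_two_mul {N : ℕ} (hN : 1 ≤ N) {f f' f'' : ℝ → ℝ}
    (hf : ∀ t, HasDerivAt f (f' t) t) (hf' : ∀ t, HasDerivAt f' (f'' t) t)
    (h1 : ∀ t ∈ Set.Icc (0 : ℝ) 1, f' t ∈ Set.Icc (1 / 8) 2)
    (h2 : ∀ t, f'' t ∈ Set.Icc (1 / 8) 2) :
    IsUniformlyConvex N fun l => ((2 : ℕ) : ℝ) * f ((l : ℝ) / N) := by
  have hN0 : (0 : ℝ) < N := by exact_mod_cast hN
  have hη : (0 : ℝ) < 1 / N := by positivity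
  have hs : ∀ l : ℕ, ((l + 1 : ℕ) : ℝ) / N = (l : ℝ) / N + 1 / N := fun l => by push_cast; ring
  refine ⟨fun l _ hl => ?_, fun l _ _ => ?_⟩
  · obtain ⟨ξ, hξ, e⟩ := exists_hasDerivAt_eq_slope f f'
      (show (l : ℝ) / N < (l : ℝ) / N + 1 / N by linarith)
      (fun t _ => (hf t).continuousAt.continuousWithinAt) (fun t _ => hf t)
    have hξ0 : 0 ≤ ξ := le_trans (by positivity) hξ.1.le
    have hξ1 : ξ ≤ 1 := by
      refine hξ.2.le.trans ?_
      rw [← hs, div_le_one hN0]; exact_mod_cast hl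
    obtain ⟨g1, g2⟩ := h1 ξ ⟨hξ0, hξ1⟩
    rw [add_sub_cancel_left, eq_div_iff hη.ne'] at e
    rw [hs, ← mul_sub, ← e]
    constructor
    · calc 1 / (4 * (N : ℝ)) = 2 * (1 / 8 * (1 / N)) := by field_simp; norm_num
        _ ≤ _ := by push_cast; gcongr
    · calc _ ≤ 2 * (2 * (1 / (N : ℝ))) := by push_cast; gcongr
        _ = _ := by ring
  · obtain ⟨ξ, e⟩ := exists_second_difference_eq hf hf' ((l : ℝ) / N) hη
    obtain ⟨g1, g2⟩ := h2 ξ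
    rw [show l + 2 = (l + 1) + 1 from rfl, hs (l + 1), hs l, ← mul_sub, ← mul_sub, ← mul_sub, e]
    constructor
    · calc 1 / (4 * (N : ℝ) ^ 2) = 2 * ((1 / N) ^ 2 * (1 / 8)) := by field_simp; norm_num
        _ ≤ _ := by push_cast; gcongr
    · calc _ ≤ 2 * ((1 / (N : ℝ)) ^ 2 * 2) := by push_cast; gcongr
        _ = _ := by ring

/-! ### Exponent bookkeeping and the fractions in `fractionSet`. -/

theorem rpow_den_sq (N : ℕ) (α : ℝ) : ((N : ℝ) ^ ((2 - α) / 3)) ^ 2 = (N : ℝ) ^ ((4 - 2 * α) / 3) := by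
  rw [← Real.rpow_natCast, ← Real.rpow_mul (by positivity)]; congr 1; push_cast; ring

theorem rpow_den_cube (N : ℕ) (α : ℝ) : ((N : ℝ) ^ ((2 - α) / 3)) ^ 3 = (N : ℝ) ^ (2 - α) := by
  rw [← Real.rpow_natCast, ← Real.rpow_mul (by positivity)]; congr 1; push_cast; ring

theorem rpow_left_mul_den {N : ℕ} (hN : 1 ≤ N) (α : ℝ) :
    (N : ℝ) ^ (α - 1) / 3 * (N : ℝ) ^ ((2 - α) / 3) = (N : ℝ) ^ ((2 * α - 1) / 3) / 3 := by
  rw [div_mul_eq_mul_div, ← Real.rpow_add (by positivity)]; congr 2; ring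

theorem rpow_left_mul_den_sq {N : ℕ} (hN : 1 ≤ N) (α : ℝ) :
    (N : ℝ) ^ (α - 1) / 3 * ((N : ℝ) ^ ((2 - α) / 3)) ^ 2 = (N : ℝ) ^ ((α + 1) / 3) / 3 := by
  rw [rpow_den_sq, div_mul_eq_mul_div, ← Real.rpow_add (by positivity)]; congr 2; ring

theorem rpow_two_sub_mul_left {N : ℕ} (hN : 1 ≤ N) (α : ℝ) : (N : ℝ) ^ (2 - α) * (N : ℝ) ^ (α - 1) = N := by
  rw [← Real.rpow_add (by positivity)]
  simp [show (2 : ℝ) - α + (α - 1) = 1 by ring]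

theorem rpow_mul_left {N : ℕ} (hN : 1 ≤ N) (α : ℝ) : (N : ℝ) * (N : ℝ) ^ (α - 1) = (N : ℝ) ^ α := by
  have hN0 : (0 : ℝ) < N := by positivity
  rw [Real.rpow_sub_one hN0.ne']; field_simp

section FractionSet

variable {N : ℕ} {α : ℝ} {n : ℕ} {r : ℕ → ℚ}

theorem finite_fractionSet (hN : 1 ≤ N) (α : ℝ) :
    (fractionSet N α).Finite ∧
      ((fractionSet N α).ncard : ℝ) ≤ (N : ℝ) ^ ((α + 1) / 3) / 3 + 1 := by
  rw [← rpow_left_mul_den_sq hN]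
  refine finite_and_ncard_le_of_den_le (x := (N : ℝ) ^ (α - 1) / 3) (by positivity)
    (by positivity) fun q hq => ⟨hq.1.1, ?_, hq.2⟩
  have := hq.1.2
  linarith

/-- The elements of `fractionSet N α` in the left half of its interval, other than `q₀`. -/
theorem exists_finset_fractionSet (hN : 1 ≤ N) (hα : α ≤ 2)
    (h : 300 ≤ (N : ℝ) ^ ((2 * α - 1) / 3)) (q₀ : ℚ) :
    ∃ S : Finset ℚ, (∀ q ∈ S, q ∈ fractionSet N α ∧ q ≠ q₀ ∧ (q : ℝ) ≤ (N : ℝ) ^ (α - 1) / 2) ∧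
      (N : ℝ) ^ ((α + 1) / 3) ≤ 930 * (S.card : ℝ) := by
  have hN' : (1 : ℝ) ≤ N := by exact_mod_cast hN
  have hQ : 1 ≤ (N : ℝ) ^ ((2 - α) / 3) := Real.one_le_rpow hN' (by linarith)
  have hL : 0 < (N : ℝ) ^ (α - 1) / 3 := by positivity
  refine ⟨(fractions ((N : ℝ) ^ (α - 1) / 3) ⌊(N : ℝ) ^ ((2 - α) / 3)⌋₊).erase q₀, ?_, ?_⟩
  · intro q hq
    rw [Finset.mem_erase] at hq
    obtain ⟨h1, h2, h3⟩ := mem_fractions hq.2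
    exact ⟨⟨⟨h1, by linarith⟩, (Nat.le_floor_iff (by positivity)).1 h3⟩, hq.1, by linarith⟩
  · have := mul_sq_le_card_fractions_erase hL hQ
      -- Here `L * Q = N ^ ((2 * α - 1) / 3) / 3`, which is why the threshold is `300`.
      (by rw [rpow_left_mul_den hN]; linarith) q₀
    rw [rpow_left_mul_den_sq hN] at this
    linarith

theorem le_ncard_fractionSet (hN : 1 ≤ N) (hα : α ≤ 2)
    (h : 300 ≤ (N : ℝ) ^ ((2 * α - 1) / 3)) :
    (N : ℝ) ^ ((α + 1) / 3) ≤ 930 * ((fractionSet N α).ncard : ℝ) := by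
  obtain ⟨S, hS, hcard⟩ := exists_finset_fractionSet hN hα h 0
  refine hcard.trans ?_
  gcongr
  rw [← Set.ncard_coe_finset]
  exact Set.ncard_le_ncard (fun q hq => (hS q hq).1) (finite_fractionSet hN α).1

theorem IsIncreasingList.mem (hr : IsIncreasingList (fractionSet N α) n r) {i : ℕ} (hi : i < n) :
    r i ∈ fractionSet N α := by
  rw [← hr.image_eq]; exact ⟨i, hi, rfl⟩

theorem IsIncreasingList.one_div_le_sub (hr : IsIncreasingList (fractionSet N α) n r) {i : ℕ}
    (hi : i + 1 < n) : 1 / (N : ℝ) ^ ((4 - 2 * α) / 3) ≤ (r (i + 1) : ℝ) - r i := by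
  rw [← rpow_den_sq]
  exact one_div_sq_le_sub_of_den_le
    (hr.strictMonoOn (show i ∈ Set.Iio n from Set.mem_Iio.2 (by omega)) hi (Nat.lt_succ_self i))
    (hr.mem (by omega)).2 (hr.mem hi).2

/-- The gap is at least `1 / Q ^ 2` and the scaling factor is `Q ^ 3`. This is what makes every
reduced denominator at most `Δ_i`. -/
theorem IsIncreasingList.le_scaledGap (hN : 1 ≤ N) (hr : IsIncreasingList (fractionSet N α) n r)
    {i : ℕ} (hi : i + 1 < n) : (N : ℝ) ^ ((2 - α) / 3) ≤ scaledGap N α r i := by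
  have h := hr.one_div_le_sub hi
  have hQ : 0 < (N : ℝ) ^ ((2 - α) / 3) := by positivity
  rw [← rpow_den_sq, div_le_iff₀ (by positivity)] at h
  rw [scaledGap, ← rpow_den_cube]
  calc (N : ℝ) ^ ((2 - α) / 3) = (N : ℝ) ^ ((2 - α) / 3) * 1 := (mul_one _).symm
    _ ≤ (N : ℝ) ^ ((2 - α) / 3) *
        (((r (i + 1) : ℝ) - r i) * ((N : ℝ) ^ ((2 - α) / 3)) ^ 2) := by gcongr
    _ = _ := by ring

theorem IsIncreasingList.exists_isChoice (hN : 1 ≤ N)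
    (hr : IsIncreasingList (fractionSet N α) n r) : ∃ a b c d, IsChoice N α n r a b c d := by
  have hrep : ∀ q : ℕ → ℚ, (∀ i, i + 1 < n → q i ∈ fractionSet N α) →
      ∃ (a : ℕ → ℤ) (b : ℕ → ℕ), ∀ i, i + 1 < n → 0 < b i ∧ q i = (a i : ℚ) / (b i : ℚ) ∧
        (b i : ℝ) ∈ Set.Icc (scaledGap N α r i) (2 * scaledGap N α r i) := by
    intro q hq
    have : ∀ i, ∃ (a : ℤ) (b : ℕ), i + 1 < n → 0 < b ∧ q i = (a : ℚ) / (b : ℚ) ∧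
        (b : ℝ) ∈ Set.Icc (scaledGap N α r i) (2 * scaledGap N α r i) := by
      intro i
      by_cases hi : i + 1 < n
      · obtain ⟨a, b, h⟩ := (q i).exists_eq_div_mem_Icc
          ((hq i hi).2.trans (hr.le_scaledGap hN hi))
        exact ⟨a, b, fun _ => h⟩
      · exact ⟨0, 0, fun hi' => absurd hi' hi⟩
    choose a b h using this
    exact ⟨a, b, h⟩
  obtain ⟨a, b, hab⟩ := hrep r fun i hi => hr.mem (by omega)
  obtain ⟨c, d, hcd⟩ := hrep (fun i => r (i + 1)) fun i hi => hr.mem hi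
  exact ⟨a, b, c, d, fun i hi => (hab i hi).1, fun i hi => (hcd i hi).1,
    fun i hi => (hab i hi).2.1, fun i hi => (hcd i hi).2.1, fun i hi => (hab i hi).2.2,
    fun i hi => (hcd i hi).2.2⟩

theorem IsIncreasingList.nodeSlope_mem (hN : 1 ≤ N)
    (hr : IsIncreasingList (fractionSet N α) n r) {i : ℕ} (hi : i < n) :
    nodeSlope N α r i ∈ Set.Icc (1 / 3) (2 / 3) := by
  obtain ⟨h1, h2⟩ := (hr.mem hi).1
  have hN0 : (0 : ℝ) < N := by positivity
  have hp : 0 < (N : ℝ) ^ (α - 1) := by positivity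
  rw [nodeSlope, ← rpow_mul_left hN, mul_div_assoc', mul_div_mul_left _ _ hN0.ne', Set.mem_Icc,
    le_div_iff₀ hp, div_le_iff₀ hp]
  constructor <;> linarith

variable {a : ℕ → ℤ} {b : ℕ → ℕ} {c : ℕ → ℤ} {d : ℕ → ℕ}

/-- Since `b j + d j ≤ 4 Δ_j`, the sum telescopes. -/
theorem IsChoice.sum_add_le (h : IsChoice N α n r a b c d) {i : ℕ} (hi : i < n) :
    ∑ j ∈ Finset.range i, ((b j + d j : ℕ) : ℝ) ≤
      4 * ((N : ℝ) ^ (2 - α) * ((r i : ℝ) - r 0)) := by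
  rw [← Finset.sum_range_sub (fun i => (r i : ℝ)), Finset.mul_sum, Finset.mul_sum]
  refine Finset.sum_le_sum fun j hj => ?_
  have hj' : j + 1 < n := by rw [Finset.mem_range] at hj; omega
  have h1 := (h.left_mem j hj').2
  have h2 := (h.right_mem j hj').2
  rw [scaledGap] at h1 h2
  push_cast
  linarith

theorem IsChoice.strictMonoOn_nodeY (hN : 1 ≤ N) (h : IsChoice N α n r a b c d)
    (hr : IsIncreasingList (fractionSet N α) n r) :
    StrictMonoOn (nodeY N α a c) (Set.Iio n) := by
  refine strictMonoOn_of_lt_succ Set.ordConnected_Iio fun i _ _ hi => ?_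
  have hi' : i + 1 < n := hi
  have hpos : ∀ j, j < n → (0 : ℝ) < r j := fun j hj =>
    lt_of_lt_of_le (by positivity) (hr.mem hj).1.1
  have hb : (0 : ℝ) < b i := by exact_mod_cast h.pos_left i hi'
  have hd : (0 : ℝ) < d i := by exact_mod_cast h.pos_right i hi'
  have h1 : (0 : ℝ) < a i + c i := by
    rw [h.left_eq_mul hi', h.right_eq_mul hi']
    have := hpos i (by omega)
    have := hpos (i + 1) hi'
    positivity
  have hX : 0 < (N : ℝ) ^ α := by positivity
  rw [Nat.succ_eq_succ, Nat.succ_eq_add_one, nodeY_succ]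
  have := div_pos h1 hX
  linarith

/-! ### Nodes as sample points, and the slope on the unit interval. -/

/-- An interpolant of the nodes meets `N^(-α) ℤ` often. -/
theorem IsChoice.le_ncard_inter_progression (hN : 1 ≤ N) (hα : α ≤ 2)
    (h : IsChoice N α n r a b c d) (hr : IsIncreasingList (fractionSet N α) n r)
    (h300 : 300 ≤ (N : ℝ) ^ ((2 * α - 1) / 3)) {f : ℝ → ℝ}
    (hf : ∀ i < n, f (nodeX N b d i) = nodeY N α a c i) {m : ℕ} (hm : 0 < m) :
    (N : ℝ) ^ ((α + 1) / 3) ≤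
      930 * ((((fun l : ℕ => (m : ℝ) * f ((l : ℝ) / (N : ℝ))) '' Set.Icc 1 N) ∩
        progression N α).ncard : ℝ) := by
  -- The fraction `r 0` is left out because its node is `x = 0`, which is not a sample point.
  obtain ⟨S, hS, hcard⟩ := exists_finset_fractionSet hN hα h300 (r 0)
  refine hcard.trans ?_
  gcongr
  set I := (Finset.range n).filter fun i => r i ∈ S with hI
  have hSI : S ⊆ I.image r := by
    intro q hq
    have h1 := (hS q hq).1
    rw [← hr.image_eq] at h1
    obtain ⟨i, hi, rfl⟩ := h1
    exact Finset.mem_image_of_mem _ (Finset.mem_filter.2 ⟨Finset.mem_range.2 hi, hq⟩)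
  refine ((Finset.card_le_card hSI).trans Finset.card_image_le).trans ?_
  rw [← Set.ncard_coe_finset]
  have hIn : ∀ i ∈ I, i < n := fun i hi => Finset.mem_range.1 (Finset.mem_filter.1 hi).1
  have hm' : (m : ℝ) ≠ 0 := by positivity
  refine Set.ncard_le_ncard_of_injOn (fun i => (m : ℝ) * nodeY N α a c i) ?_ ?_
    (((Set.finite_Icc 1 N).image _).inter_of_left _)
  · intro i hi
    have hi' := Finset.mem_coe.1 hi
    have hin := hIn i hi'
    obtain ⟨-, hne, hle⟩ := hS _ (Finset.mem_filter.1 hi').2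
    have hi0 : i ≠ 0 := by rintro rfl; exact hne rfl
    -- The sample index is `N * x_i`. It is at most `4 * N / 6 ≤ N`, because `r 0` and `r i` both
    -- lie in the left half of the interval, of length `N ^ (α - 1) / 6`.
    refine ⟨⟨∑ j ∈ Finset.range i, (b j + d j), ⟨?_, ?_⟩, ?_⟩, ?_⟩
    · refine le_trans ?_ (Finset.single_le_sum (f := fun j => b j + d j)
        (fun _ _ => Nat.zero_le _) (Finset.mem_range.2 (Nat.pos_of_ne_zero hi0)))
      have := h.pos_left 0 (by omega)
      omega
    · have h1 := h.sum_add_le hin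
      have h0 := (hr.mem (show 0 < n by omega)).1.1
      have hY : 0 < (N : ℝ) ^ (2 - α) := by positivity
      have h2 : (N : ℝ) ^ (2 - α) * ((r i : ℝ) - r 0) ≤
          (N : ℝ) ^ (2 - α) * ((N : ℝ) ^ (α - 1) / 6) := by gcongr; linarith
      rw [mul_div_assoc', rpow_two_sub_mul_left hN] at h2
      have h3 : ((∑ j ∈ Finset.range i, (b j + d j) : ℕ) : ℝ) ≤ N := by
        rw [Nat.cast_sum]
        have : (0 : ℝ) ≤ N := by positivity
        linarith
      exact_mod_cast h3
    · dsimp only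
      rw [← hf i hin, nodeX, Nat.cast_sum, one_div_mul_eq_div]
    · refine ⟨m * ∑ j ∈ Finset.range i, (a j + c j), ?_⟩
      dsimp only
      rw [nodeY, Real.rpow_neg (by positivity)]
      push_cast
      ring
  · intro i hi j hj hij
    exact (h.strictMonoOn_nodeY hN hr).injOn (hIn i (Finset.mem_coe.1 hi))
      (hIn j (Finset.mem_coe.1 hj)) (mul_left_cancel₀ hm' hij)

/-- On `[0, 1]` the slopes of the interpolant lie in `[1/8, 2]`. -/
theorem IsIncreasingList.slope_mem (hN : 1 ≤ N) (hr : IsIncreasingList (fractionSet N α) n r)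
    (hn : 0 < n) {f' f'' : ℝ → ℝ} (hf' : ∀ t, HasDerivAt f' (f'' t) t)
    (hp : ∀ i < n, f' (nodeX N b d i) = nodeSlope N α r i) (hpos : ∀ t, 0 ≤ f'' t)
    (he : ∀ t, nodeX N b d (n - 1) ≤ t →
      f' t = nodeSlope N α r (n - 1) + (t - nodeX N b d (n - 1)) / 8) :
    ∀ t ∈ Set.Icc (0 : ℝ) 1, f' t ∈ Set.Icc (1 / 8) 2 := by
  have hmono : Monotone f' := monotone_of_hasDerivAt_nonneg hf' hpos
  have hlast := (hr.nodeSlope_mem hN (show n - 1 < n by omega)).2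
  rintro t ⟨ht0, ht1⟩
  constructor
  · have h0 := hp 0 hn
    rw [show nodeX N b d 0 = 0 by simp [nodeX]] at h0
    linarith [hmono ht0, (hr.nodeSlope_mem hN hn).1]
  -- The last node may lie to the left of `1`; beyond it the slope grows at rate `1 / 8` from at
  -- most `2 / 3`.
  · rcases le_total (nodeX N b d (n - 1)) t with h | h
    · have hx : 0 ≤ nodeX N b d (n - 1) := by unfold nodeX; positivity
      rw [he t h]; linarith
    · linarith [hmono h, hp (n - 1) (by omega)]

end FractionSet

/-! ### Assembly. -/

theorem mainTheorem4 :
    ∃ C : ℝ, 0 < C ∧ ∀ α : ℝ, α ∈ Set.Icc (1 / 2 : ℝ) 2 → ∀ N : ℕ, 1 ≤ N →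
      -- the number of fractions is `∼ N^((α+1)/3)`
      (fractionSet N α).Finite ∧
      ((fractionSet N α).ncard : ℝ) ≤ C * (N : ℝ) ^ ((α + 1) / 3) ∧
      (300 ≤ (N : ℝ) ^ ((2 * α - 1) / 3) →
        (N : ℝ) ^ ((α + 1) / 3) ≤ C * ((fractionSet N α).ncard : ℝ)) ∧
      ∀ (n : ℕ) (r : ℕ → ℚ), IsIncreasingList (fractionSet N α) n r →
        -- neighbouring fractions are separated
        (∀ i, i + 1 < n →
          1 / (N : ℝ) ^ ((4 - 2 * α) / 3) ≤ C * ((r (i + 1) : ℝ) - (r i : ℝ))) ∧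
        -- the denominators can be chosen as required
        (∃ a b c d, IsChoice N α n r a b c d) ∧
        -- every such choice gives data with a uniformly convex `C²` interpolant
        ∀ a b c d, IsChoice N α n r a b c d →
          ∃ f : ℝ → ℝ, ConvexOn ℝ Set.univ f ∧ ContDiff ℝ 2 f ∧
            (∀ i, i < n → f (nodeX N b d i) = nodeY N α a c i) ∧
            (∀ i, i < n → deriv f (nodeX N b d i) = nodeSlope N α r i) ∧
            (∀ x, 1 / C ≤ deriv (deriv f) x ∧ deriv (deriv f) x ≤ C) ∧
            -- sampling a multiple of `f` gives a uniformly convex sequence that meets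
            -- `N^(-α) ℤ` in `≳ N^((α+1)/3)` points
            (300 ≤ (N : ℝ) ^ ((2 * α - 1) / 3) →
              ∃ m : ℕ, 0 < m ∧
                IsUniformlyConvex N (fun l => (m : ℝ) * f ((l : ℝ) / (N : ℝ))) ∧
                (N : ℝ) ^ ((α + 1) / 3) ≤
                  C * ((((fun l : ℕ => (m : ℝ) * f ((l : ℝ) / (N : ℝ))) '' Set.Icc 1 N) ∩
                    progression N α).ncard : ℝ)) := by
  -- The constant is generous; the largest one needed is the `930` of the lower counts.
  refine ⟨2000, by norm_num, fun α hα N hN => ?_⟩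
  have hN' : (1 : ℝ) ≤ N := by exact_mod_cast hN
  obtain ⟨hfin, hupper⟩ := finite_fractionSet hN α
  have hone : 1 ≤ (N : ℝ) ^ ((α + 1) / 3) := Real.one_le_rpow hN' (by linarith [hα.1])
  refine ⟨hfin, by linarith, fun h300 => ?_, fun n r hr => ⟨fun i hi => ?_,
    hr.exists_isChoice hN, fun a b c d h => ?_⟩⟩
  · have := le_ncard_fractionSet hN hα.2 h300
    have : (0 : ℝ) ≤ (fractionSet N α).ncard := by positivity
    linarith
  · have h1 := hr.one_div_le_sub hi
    have h2 : 0 ≤ 1 / (N : ℝ) ^ ((4 - 2 * α) / 3) := by positivity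
    linarith
  obtain ⟨f, f', f'', hf, hf', hc, hy, hp, hb, he⟩ := h.exists_interpolant hN fun i hi =>
    lt_of_lt_of_le (by positivity) (hr.le_scaledGap hN hi)
  have e1 : deriv f = f' := funext fun t => (hf t).deriv
  have e2 : deriv f' = f'' := funext fun t => (hf' t).deriv
  have hpos : ∀ t, 0 ≤ f'' t := fun t => le_trans (by norm_num) (hb t).1
  -- The multiple `m = 2` moves the range `[1/8, 2]` of the derivatives to the required `[1/4, 4]`.
  refine ⟨f, ?_, ?_, hy, by rwa [e1], ?_, fun h300 => ⟨2, two_pos, ?_, ?_⟩⟩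
  · refine convexOn_univ_of_deriv2_nonneg (fun t => (hf t).differentiableAt) ?_ ?_
    · rw [e1]; exact fun t => (hf' t).differentiableAt
    · intro t
      simp only [Function.iterate_succ, Function.iterate_zero, Function.comp_apply, id_eq]
      rw [e1, e2]; exact hpos t
  · rw [show (2 : WithTop ℕ∞) = 1 + 1 by norm_num, contDiff_succ_iff_deriv, e1]
    refine ⟨fun t => (hf t).differentiableAt, by simp, ?_⟩
    rw [contDiff_one_iff_deriv, e2]
    exact ⟨fun t => (hf' t).differentiableAt, hc⟩
  · intro t
    rw [e1, e2]
    constructor <;> linarith [(hb t).1, (hb t).2]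
  · have hn : 0 < n := by
      by_contra h0
      obtain rfl : n = 0 := by omega
      have h1 := le_ncard_fractionSet hN hα.2 h300
      rw [← hr.image_eq] at h1
      simp at h1
      linarith
    exact isUniformlyConvex_two_mul hN hf hf' (hr.slope_mem hN hn hf' hp hpos he) hb
  · exact (h.le_ncard_inter_progression hN hα.2 hr h300 hy two_pos).trans (by gcongr; norm_num)
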